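/- For $0<\alpha\le 1/2$ let $S_1,S_2$ be independent random variables with the maximally skewed $\alpha$-stable law $S(\alpha,1,1)$, i.e. with characteristic function $$\mathbb E\, e^{i\lambda S_j}=\exp\!\Big(-|\lambda|^\alpha\big(1-i\,\mathrm{sign}(\lambda)\tan\tfrac{\pi\alpha}{2}\big)\Big),\qquad \lambda\in\mathbb R,$$ and let $F_\alpha(t)=\Pr\big((S_2/S_1)^{\alpha/(1-\alpha)}\le t\big)$ for $t\ge 0$. There are constants $C_\alpha>0$ $(0<\alpha\le 1/2)$, depending only on $\alpha$, with $C_\alpha\to 1$ as $\alpha\to0^+$ and $C_{1/2}=\pi/2$, and a function $r(\alpha,t)$ with $r(\alpha,t)\to 0$ as $t\to0^+$, uniformly in $\alpha\in(0,1/2]$, such that for all $0<\alpha\le 1/2$ and $0\le t<\alpha^{\alpha/(1-\alpha)}$ $$C_\alpha+r(\alpha,t)>0\qquad\text{and}\qquad F_\alpha(t)=\frac{t^{1-\alpha}}{C_\alpha+r(\alpha,t)}.$$ Moreover $F_\alpha(t)=\Theta(t^{1-\alpha})$ uniformly: there are absolute constants $c_1,c_2>0$ with $c_1t^{1-\alpha}\le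 F_\alpha(t)\le c_2t^{1-\alpha}$ for all $0<\alpha\le 1/2$ and $0\le t<\alpha^{\alpha/(1-\alpha)}$. -/

import Mathlib

open MeasureTheory ProbabilityTheory Filter Topology

/-- The characteristic function `λ ↦ exp(-γ |λ|^α (1 - i sign(λ) tan(π α / 2)))` of the
maximally skewed `α`-stable distribution `S(α, 1, γ)` (for `α ≠ 1`). -/
noncomputable def skewStableCharFun (α γ l : ℝ) : ℂ :=
  Complex.exp
    (-((γ * |l| ^ α : ℝ) : ℂ) *
      (1 - ((SignType.sign l : ℝ) : ℂ) * Complex.I * ((Real.tan (Real.pi * α / 2) : ℝ) : ℂ)))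

/-- The real random variable `Z` has the maximally skewed stable law `S(α, 1, γ)`:
`E exp(i l Z)` is the above function of `l`. -/
structure IsSkewStable {Ω : Type*} [MeasurableSpace Ω] (α γ : ℝ) (Z : Ω → ℝ)
    (P : Measure Ω) : Prop where
  aemeasurable : AEMeasurable Z P
  charFun_map : ∀ l : ℝ, charFun (P.map Z) l = skewStableCharFun α γ l

/-- `F_α(t) = P((S₂ / S₁)^(α / (1 - α)) ≤ t)`. -/
noncomputable def ratioCDF {Ω : Type*} [MeasurableSpace Ω] (P : Measure Ω)
    (S₁ S₂ : Ω → ℝ) (α t : ℝ) : ℝ :=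
  P.real {ω | (S₂ ω / S₁ ω) ^ (α / (1 - α)) ≤ t}

/-! The law of the ratio is explicit. Put `T = tan (π α / 2)`. For `b > 0`, `S₂ - b S₁` has
characteristic function `exp (-(1 + b^α) l^α + i T (1 - b^α) l^α)` at `l > 0`. The Gil-Pelaez
formula and the substitution `u = l^α` turn the mean of its sign into an arctangent
(`integral_sign_of_charFun_im`); the case of one variable shows that `S₁, S₂ > 0` a.s. Hence `F_α(t)
= G(t^(1-α))` with `G = powRatioCDF α` (`ratioCDF_eq_powRatioCDF`).

Here `G(0) = 0` and `G'(0) = sin (π α) / (π α) = 1 / C_α`. Bounding `G'` on both sides gives `x /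
((1 + x) C_α) ≤ G(x) ≤ x / C_α` (`powRatioCDF_bounds`), so `0 ≤ r(α, t) ≤ C_α t^(1-α)`. Since `1 ≤
C_α ≤ π / 2`, all claims follow. -/

/-! ### Laplace transform of `sin (c u) / u`. -/

lemma abs_sin_mul_div_le (c u : ℝ) : |Real.sin (c * u) / u| ≤ |c| := by
  rcases eq_or_ne u 0 with rfl | hu
  · simp
  · rw [abs_div, div_le_iff₀ (abs_pos.mpr hu), ← abs_mul]
    exact Real.abs_sin_le_abs

lemma integrableOn_exp_neg_mul_Ioi {a : ℝ} (ha : 0 < a) :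
    IntegrableOn (fun u : ℝ => Real.exp (-a * u)) (Set.Ioi 0) :=
  integrableOn_exp_mul_Ioi (by linarith) 0

lemma integral_exp_neg_mul_cos {a : ℝ} (ha : 0 < a) (s : ℝ) :
    ∫ u in Set.Ioi (0 : ℝ), Real.exp (-a * u) * Real.cos (s * u) = a / (a ^ 2 + s ^ 2) := by
  have hre : ((-a : ℂ) + s * Complex.I).re < 0 := by simpa using ha
  have h := integral_exp_mul_complex_Ioi hre 0
  have h2 := integral_re (integrableOn_exp_mul_complex_Ioi hre 0)
  rw [h] at h2
  have h3 : ∀ u : ℝ, RCLike.re (Complex.exp (((-a : ℂ) + s * Complex.I) * u))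
      = Real.exp (-a * u) * Real.cos (s * u) := by
    intro u
    simp [Complex.exp_re]
  simp only [h3] at h2
  rw [h2]
  simp [Complex.normSq_apply, neg_div]
  ring_nf

lemma integrableOn_exp_neg_mul_sin_div {a : ℝ} (ha : 0 < a) (c : ℝ) :
    IntegrableOn (fun u : ℝ => Real.exp (-a * u) * (Real.sin (c * u) / u)) (Set.Ioi 0) := by
  refine Integrable.mono' ((integrableOn_exp_neg_mul_Ioi ha).const_mul |c|) (by fun_prop) ?_
  refine ae_of_all _ fun u => ?_
  rw [norm_mul, Real.norm_eq_abs, Real.norm_eq_abs, Real.abs_exp, mul_comm]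
  exact mul_le_mul_of_nonneg_right (abs_sin_mul_div_le c u) (Real.exp_nonneg _)

/-- Fubini applied to `sin (c u) / u = ∫ s in 0..c, cos (s u)`. -/
lemma integral_exp_neg_mul_sin_div {a : ℝ} (ha : 0 < a) (c : ℝ) :
    ∫ u in Set.Ioi (0 : ℝ), Real.exp (-a * u) * (Real.sin (c * u) / u) = Real.arctan (c / a) := by
  have h1 : ∫ u in Set.Ioi (0 : ℝ), Real.exp (-a * u) * (Real.sin (c * u) / u)
      = ∫ u in Set.Ioi (0 : ℝ), ∫ s in (0 : ℝ)..c, Real.exp (-a * u) * Real.cos (s * u) := by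
    refine setIntegral_congr_fun measurableSet_Ioi fun u hu => ?_
    have hu : (u : ℝ) ≠ 0 := ne_of_gt hu
    simp only [intervalIntegral.integral_const_mul]
    rw [intervalIntegral.integral_comp_mul_right _ hu]
    simp [div_eq_inv_mul]
  rw [h1, ← intervalIntegral_integral_swap]
  · simp only [integral_exp_neg_mul_cos ha]
    simp [integral_div_sq_add_sq]
  · have : IsFiniteMeasure (volume.restrict (Set.uIoc 0 c)) := by
      rw [Set.uIoc]; infer_instance
    have hd : Integrable (fun z : ℝ × ℝ => (1 : ℝ) * Real.exp (-a * z.2))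
        ((volume.restrict (Set.uIoc 0 c)).prod (volume.restrict (Set.Ioi 0))) :=
      Integrable.mul_prod (f := fun _ : ℝ => (1 : ℝ)) (integrable_const _)
        (integrableOn_exp_neg_mul_Ioi ha)
    refine hd.mono' (by fun_prop) (ae_of_all _ fun z => ?_)
    simp only [Function.uncurry, norm_mul, Real.norm_eq_abs, Real.abs_exp, one_mul]
    exact mul_le_of_le_one_right (Real.exp_nonneg _) (Real.abs_cos_le_one _)

/-! ### Gil-Pelaez inversion at the origin. -/

lemma charFun_im_real (μ : Measure ℝ) [IsProbabilityMeasure μ] (l : ℝ) :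
    (charFun μ l).im = ∫ x, Real.sin (l * x) ∂μ := by
  rw [charFun_apply_real]
  have hi : Integrable (fun x : ℝ => Complex.exp (l * x * Complex.I)) μ := by
    refine Integrable.mono' (integrable_const (1 : ℝ)) (by fun_prop) (ae_of_all _ fun x => ?_)
    rw [← Complex.ofReal_mul, Complex.norm_exp_ofReal_mul_I]
  have h := integral_im hi
  refine h.symm.trans (integral_congr_ae (ae_of_all _ fun x => ?_))
  simp [Complex.exp_im]

lemma exp_neg_sub_exp_neg_nonneg {e M l : ℝ} (hM : e ≤ M) (hl : 0 ≤ l) :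
    0 ≤ Real.exp (-e * l) - Real.exp (-M * l) := by
  rw [sub_nonneg, Real.exp_le_exp]
  nlinarith

/-- The kernel vanishes at `l = 0`, which tames the factor `1 / l` uniformly in `x`: Fubini then
needs no moment of `μ`. -/
lemma exp_neg_sub_exp_neg_div_le {e M l : ℝ} (hl : 0 < l) :
    (Real.exp (-e * l) - Real.exp (-M * l)) / l ≤ (M - e) * Real.exp (-e * l) := by
  rw [div_le_iff₀ hl]
  have h := Real.add_one_le_exp (-(M - e) * l)
  have h2 : Real.exp (-M * l) = Real.exp (-e * l) * Real.exp (-(M - e) * l) := by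
    rw [← Real.exp_add]; ring_nf
  rw [h2]
  nlinarith [Real.exp_pos (-e * l), mul_le_mul_of_nonneg_left h (Real.exp_pos (-e * l)).le]

/-- Smoothed inversion formula: the smoothing kernel is `λ ↦ e^{-eλ} - e^{-Mλ}`. -/
lemma integral_arctan_sub_arctan_eq (μ : Measure ℝ) [IsProbabilityMeasure μ] {e M : ℝ}
    (he : 0 < e) (hM : e ≤ M) :
    ∫ x, (Real.arctan (x / e) - Real.arctan (x / M)) ∂μ =
      ∫ l in Set.Ioi (0 : ℝ), (Real.exp (-e * l) - Real.exp (-M * l)) * ((charFun μ l).im / l) := by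
  have hM0 : 0 < M := he.trans_le hM
  have h1 : ∀ x : ℝ, Real.arctan (x / e) - Real.arctan (x / M) =
      ∫ l in Set.Ioi (0 : ℝ),
        (Real.exp (-e * l) - Real.exp (-M * l)) * (Real.sin (x * l) / l) := by
    intro x
    rw [← integral_exp_neg_mul_sin_div he, ← integral_exp_neg_mul_sin_div hM0,
      ← integral_sub (integrableOn_exp_neg_mul_sin_div he x)
        (integrableOn_exp_neg_mul_sin_div hM0 x)]
    simp only [sub_mul]
  simp only [h1]
  rw [integral_integral_swap]
  · refine setIntegral_congr_fun measurableSet_Ioi fun l _ => ?_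
    simp only [charFun_im_real, integral_const_mul, integral_div, mul_comm l]
  · have hd : Integrable (fun z : ℝ × ℝ => (1 : ℝ) * ((M - e) * Real.exp (-e * z.2)))
        (μ.prod (volume.restrict (Set.Ioi 0))) :=
      Integrable.mul_prod (f := fun _ : ℝ => (1 : ℝ)) (integrable_const _)
        ((integrableOn_exp_neg_mul_Ioi he).const_mul _)
    refine hd.mono' (Measurable.aestronglyMeasurable (by fun_prop)) ?_
    have hpos : ∀ᵐ z : ℝ × ℝ ∂(μ.prod (volume.restrict (Set.Ioi 0))), 0 < z.2 :=
      Measure.quasiMeasurePreserving_snd.ae (ae_restrict_mem measurableSet_Ioi)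
    filter_upwards [hpos] with z hz
    have hn := exp_neg_sub_exp_neg_nonneg hM hz.le
    simp only [Function.uncurry, one_mul, Real.norm_eq_abs]
    refine le_trans ?_ (exp_neg_sub_exp_neg_div_le hz)
    rw [mul_div_assoc', abs_div, abs_mul, abs_of_nonneg hn, abs_of_pos hz]
    gcongr
    exact mul_le_of_le_one_right hn (Real.abs_sin_le_one _)

lemma tendsto_arctan_div_nhdsGT_zero (x : ℝ) :
    Tendsto (fun e : ℝ => Real.arctan (x / e)) (𝓝[>] 0)
      (𝓝 (Real.pi / 2 * (SignType.sign x : ℝ))) := by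
  rcases lt_trichotomy x 0 with hx | rfl | hx
  · rw [sign_neg hx]
    have h : Tendsto (fun e : ℝ => x / e) (𝓝[>] 0) atBot := by
      simp only [div_eq_mul_inv]
      exact tendsto_inv_nhdsGT_zero.const_mul_atTop_of_neg hx
    simpa [Function.comp_def] using
      (tendsto_nhds_of_tendsto_nhdsWithin Real.tendsto_arctan_atBot).comp h
  · simp
  · rw [sign_pos hx]
    have h : Tendsto (fun e : ℝ => x / e) (𝓝[>] 0) atTop := by
      simp only [div_eq_mul_inv]
      exact tendsto_inv_nhdsGT_zero.const_mul_atTop hx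
    simpa [Function.comp_def] using
      (tendsto_nhds_of_tendsto_nhdsWithin Real.tendsto_arctan_atTop).comp h

lemma abs_arctan_le_pi_div_two (x : ℝ) : |Real.arctan x| ≤ Real.pi / 2 :=
  abs_le.mpr ⟨(Real.neg_pi_div_two_lt_arctan x).le, (Real.arctan_lt_pi_div_two x).le⟩

/-- The **Gil-Pelaez formula** at `0`, for absolutely convergent inversion integrals. -/
theorem integral_sign_eq_integral_charFun_im (μ : Measure ℝ) [IsProbabilityMeasure μ]
    (hint : IntegrableOn (fun l => (charFun μ l).im / l) (Set.Ioi 0)) :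
    ∫ x, (SignType.sign x : ℝ) ∂μ =
      2 / Real.pi * ∫ l in Set.Ioi (0 : ℝ), (charFun μ l).im / l := by
  -- Taking `M = e⁻¹` removes both cutoffs with a single limit `e → 0+`.
  have hL : Tendsto (fun e : ℝ => ∫ x, (Real.arctan (x / e) - Real.arctan (x / e⁻¹)) ∂μ)
      (𝓝[>] 0) (𝓝 (∫ x, Real.pi / 2 * (SignType.sign x : ℝ) ∂μ)) := by
    refine tendsto_integral_filter_of_dominated_convergence (fun _ => Real.pi)
      (Eventually.of_forall fun e => by fun_prop) (Eventually.of_forall fun e => ?_)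
      (integrable_const _) (ae_of_all _ fun x => ?_)
    · refine ae_of_all _ fun x => (norm_sub_le _ _).trans ?_
      have h1 := abs_arctan_le_pi_div_two (x / e)
      have h2 := abs_arctan_le_pi_div_two (x / e⁻¹)
      simp only [Real.norm_eq_abs]
      linarith
    · have h2 : Tendsto (fun e : ℝ => Real.arctan (x / e⁻¹)) (𝓝[>] 0) (𝓝 0) := by
        have : Tendsto (fun e : ℝ => Real.arctan (x * e)) (𝓝 0) (𝓝 (Real.arctan (x * 0))) := by
          apply Continuous.tendsto (by fun_prop)
        simpa using this.mono_left nhdsWithin_le_nhds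
      simpa using (tendsto_arctan_div_nhdsGT_zero x).sub h2
  have hR : Tendsto (fun e : ℝ => ∫ l in Set.Ioi (0 : ℝ),
      (Real.exp (-e * l) - Real.exp (-e⁻¹ * l)) * ((charFun μ l).im / l))
      (𝓝[>] 0) (𝓝 (∫ l in Set.Ioi (0 : ℝ), (charFun μ l).im / l)) := by
    refine tendsto_integral_filter_of_dominated_convergence (fun l => ‖(charFun μ l).im / l‖)
      (Eventually.of_forall fun e => ?_) ?_ hint.norm ?_
    · exact AEStronglyMeasurable.mul (by fun_prop) hint.aestronglyMeasurable
    · filter_upwards [Ioo_mem_nhdsGT (one_pos : (0 : ℝ) < 1)] with e he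
      filter_upwards [ae_restrict_mem measurableSet_Ioi] with l hl
      have hl : 0 < l := hl
      have hle : e ≤ e⁻¹ := he.2.le.trans ((one_le_inv₀ he.1).mpr he.2.le)
      rw [norm_mul, Real.norm_eq_abs, abs_of_nonneg (exp_neg_sub_exp_neg_nonneg hle hl.le)]
      refine mul_le_of_le_one_left (norm_nonneg _) ?_
      have h1 : Real.exp (-e * l) ≤ 1 := Real.exp_le_one_iff.mpr (by nlinarith [he.1])
      linarith [Real.exp_pos (-e⁻¹ * l)]
    · filter_upwards [ae_restrict_mem measurableSet_Ioi] with l hl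
      have hl : 0 < l := hl
      have h1 : Tendsto (fun e : ℝ => Real.exp (-e * l)) (𝓝[>] 0) (𝓝 1) := by
        have : Tendsto (fun e : ℝ => Real.exp (-e * l)) (𝓝 0) (𝓝 (Real.exp (-0 * l))) := by
          apply Continuous.tendsto (by fun_prop)
        simpa using this.mono_left nhdsWithin_le_nhds
      have h2 : Tendsto (fun e : ℝ => Real.exp (-e⁻¹ * l)) (𝓝[>] 0) (𝓝 0) := by
        refine Real.tendsto_exp_atBot.comp ?_
        simp only [neg_mul]
        exact tendsto_neg_atTop_atBot.comp (tendsto_inv_nhdsGT_zero.atTop_mul_const hl)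
      simpa using (h1.sub h2).mul_const ((charFun μ l).im / l)
  have heq : ∀ᶠ e : ℝ in 𝓝[>] 0,
      ∫ x, (Real.arctan (x / e) - Real.arctan (x / e⁻¹)) ∂μ =
      ∫ l in Set.Ioi (0 : ℝ),
        (Real.exp (-e * l) - Real.exp (-e⁻¹ * l)) * ((charFun μ l).im / l) := by
    filter_upwards [Ioo_mem_nhdsGT (one_pos : (0 : ℝ) < 1)] with e he
    exact integral_arctan_sub_arctan_eq μ he.1 (he.2.le.trans ((one_le_inv₀ he.1).mpr he.2.le))
  have h := tendsto_nhds_unique (hL.congr' heq) hR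
  rw [integral_const_mul] at h
  rw [← h]
  field_simp

/-- The sign integral for a law whose characteristic function on `(0, ∞)` is
`λ ↦ exp(-(a - i c) λ^α)`. -/
theorem integral_sign_of_charFun_im (μ : Measure ℝ) [IsProbabilityMeasure μ] {α a c : ℝ}
    (hα : 0 < α) (ha : 0 < a)
    (h : ∀ l : ℝ, 0 < l → (charFun μ l).im = Real.exp (-a * l ^ α) * Real.sin (c * l ^ α)) :
    ∫ x, (SignType.sign x : ℝ) ∂μ = 2 / (Real.pi * α) * Real.arctan (c / a) := by
  -- Prepares the substitution `u = l^α`, for which `dl / l = α⁻¹ du / u`.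
  have key : ∀ l ∈ Set.Ioi (0 : ℝ), (charFun μ l).im / l =
      α⁻¹ * ((α * l ^ (α - 1)) •
        (Real.exp (-a * l ^ α) * (Real.sin (c * l ^ α) / l ^ α))) := by
    intro l hl
    have hl : 0 < l := hl
    rw [h l hl, Real.rpow_sub_one hl.ne', smul_eq_mul]
    have := (Real.rpow_pos_of_pos hl α).ne'
    field_simp
  have hint : IntegrableOn (fun l => (charFun μ l).im / l) (Set.Ioi 0) := by
    rw [integrableOn_congr_fun key measurableSet_Ioi]
    refine Integrable.const_mul ?_ _
    have := (integrableOn_Ioi_comp_rpow_iff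
      (fun u => Real.exp (-a * u) * (Real.sin (c * u) / u)) hα.ne').mpr
      (integrableOn_exp_neg_mul_sin_div ha c)
    rwa [abs_of_pos hα] at this
  rw [integral_sign_eq_integral_charFun_im μ hint, setIntegral_congr_fun measurableSet_Ioi key,
    integral_const_mul, integral_comp_rpow_Ioi_of_pos
      (g := fun u => Real.exp (-a * u) * (Real.sin (c * u) / u)) hα,
    integral_exp_neg_mul_sin_div ha]
  field_simp

/-! ### From the mean of the sign to half-line probabilities. -/

lemma measurable_coe_sign : Measurable fun x : ℝ => (SignType.sign x : ℝ) := by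
  have h : (fun x : ℝ => (SignType.sign x : ℝ)) =
      fun x => if 0 < x then 1 else if x < 0 then -1 else 0 := by
    funext x
    rcases lt_trichotomy x 0 with hx | rfl | hx <;> simp [*, not_lt_of_gt]
  rw [h]
  exact Measurable.ite measurableSet_Ioi measurable_const
    (Measurable.ite measurableSet_Iio measurable_const measurable_const)

lemma abs_coe_sign_le_one (x : ℝ) : |(SignType.sign x : ℝ)| ≤ 1 := by
  rcases lt_trichotomy x 0 with hx | rfl | hx <;> simp [*]

lemma integrable_coe_sign (μ : Measure ℝ) [IsFiniteMeasure μ] :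
    Integrable (fun x : ℝ => (SignType.sign x : ℝ)) μ :=
  (integrable_const (1 : ℝ)).mono' measurable_coe_sign.aestronglyMeasurable
    (ae_of_all _ abs_coe_sign_le_one)

lemma integral_one_sub_sign_div_two (μ : Measure ℝ) [IsProbabilityMeasure μ] :
    ∫ x, (1 - (SignType.sign x : ℝ)) / 2 ∂μ = (1 - ∫ x, (SignType.sign x : ℝ) ∂μ) / 2 := by
  rw [integral_div, integral_sub (integrable_const _) (integrable_coe_sign μ)]
  simp

lemma integrable_one_sub_sign_div_two (μ : Measure ℝ) [IsProbabilityMeasure μ] :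
    Integrable (fun x : ℝ => (1 - (SignType.sign x : ℝ)) / 2) μ :=
  ((integrable_const _).sub (integrable_coe_sign μ)).div_const 2

/-- `(1 - sign) / 2` gives weight `1 / 2` to the origin, so a possible atom there leaves one
inequality for `Iio` and the opposite one for `Iic`. -/
lemma measureReal_Iio_le_of_integral_sign (μ : Measure ℝ) [IsProbabilityMeasure μ] :
    μ.real (Set.Iio 0) ≤ (1 - ∫ x, (SignType.sign x : ℝ) ∂μ) / 2 := by
  rw [← integral_indicator_one measurableSet_Iio, ← integral_one_sub_sign_div_two]
  refine integral_mono ((integrable_const (1 : ℝ)).indicator measurableSet_Iio)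
    (integrable_one_sub_sign_div_two μ) fun x => ?_
  rcases lt_trichotomy x 0 with hx | rfl | hx <;> simp [Set.indicator, *, not_lt_of_gt]

lemma le_measureReal_Iic_of_integral_sign (μ : Measure ℝ) [IsProbabilityMeasure μ] :
    (1 - ∫ x, (SignType.sign x : ℝ) ∂μ) / 2 ≤ μ.real (Set.Iic 0) := by
  rw [← integral_indicator_one measurableSet_Iic, ← integral_one_sub_sign_div_two]
  refine integral_mono (integrable_one_sub_sign_div_two μ)
    ((integrable_const (1 : ℝ)).indicator measurableSet_Iic) fun x => ?_
  rcases lt_trichotomy x 0 with hx | rfl | hx <;>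
    simp [Set.indicator, *, le_of_lt, not_le_of_gt]
  norm_num

lemma ae_pos_of_integral_sign_eq_one (μ : Measure ℝ) [IsProbabilityMeasure μ]
    (h : ∫ x, (SignType.sign x : ℝ) ∂μ = 1) : ∀ᵐ x ∂μ, 0 < x := by
  have h0 : ∫ x, (1 - (SignType.sign x : ℝ)) / 2 ∂μ = 0 := by
    rw [integral_one_sub_sign_div_two, h]; simp
  rw [integral_eq_zero_iff_of_nonneg (fun x => ?_) (integrable_one_sub_sign_div_two μ)] at h0
  · filter_upwards [h0] with x hx
    rcases lt_trichotomy x 0 with h' | rfl | h'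
    · norm_num [sign_neg h'] at hx
    · norm_num at hx
    · exact h'
  · have := (abs_le.mp (abs_coe_sign_le_one x)).2
    simp only [Pi.zero_apply]
    linarith

/-! ### Skew stable laws and the exact distribution of the ratio. -/

section SkewStable

variable {Ω : Type*} [MeasurableSpace Ω] {P : Measure Ω} [IsProbabilityMeasure P]
  {S S₁ S₂ : Ω → ℝ} {α : ℝ}

lemma skewStableCharFun_one_of_pos (α : ℝ) {l : ℝ} (hl : 0 < l) :
    skewStableCharFun α 1 l = Complex.exp
      ((-(l ^ α) : ℝ) + (Real.tan (Real.pi * α / 2) * l ^ α : ℝ) * Complex.I) := by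
  rw [skewStableCharFun, abs_of_pos hl, sign_pos hl]
  congr 1
  push_cast
  simp
  ring

lemma skewStableCharFun_one_neg (α : ℝ) {l : ℝ} (hl : 0 < l) :
    skewStableCharFun α 1 (-l) = Complex.exp
      ((-(l ^ α) : ℝ) + (-(Real.tan (Real.pi * α / 2) * l ^ α) : ℝ) * Complex.I) := by
  rw [skewStableCharFun, abs_neg, abs_of_pos hl, sign_neg (neg_lt_zero.mpr hl)]
  congr 1
  push_cast
  simp
  ring

lemma exp_ofReal_add_ofReal_mul_I_im (p q : ℝ) :
    (Complex.exp (p + q * Complex.I)).im = Real.exp p * Real.sin q := by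
  simp [Complex.exp_im]

lemma arctan_tan_pi_mul_div_two (hα : 0 < α) (hα1 : α < 1) :
    Real.arctan (Real.tan (Real.pi * α / 2)) = Real.pi * α / 2 :=
  Real.arctan_tan (by nlinarith [Real.pi_pos]) (by nlinarith [Real.pi_pos])

/-- A maximally skewed `α`-stable variable with `α < 1` is almost surely positive. -/
theorem IsSkewStable.ae_pos (hα : 0 < α) (hα1 : α < 1) (h : IsSkewStable α 1 S P) :
    ∀ᵐ ω ∂P, 0 < S ω := by
  have := Measure.isProbabilityMeasure_map (μ := P) h.aemeasurable
  refine ae_of_ae_map h.aemeasurable (ae_pos_of_integral_sign_eq_one _ ?_)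
  rw [integral_sign_of_charFun_im (P.map S) (a := 1) (c := Real.tan (Real.pi * α / 2)) hα one_pos,
    div_one, arctan_tan_pi_mul_div_two hα hα1]
  · field_simp
  · intro l hl
    rw [h.charFun_map, skewStableCharFun_one_of_pos α hl, exp_ofReal_add_ofReal_mul_I_im]
    ring_nf

lemma charFun_map_sub_mul (h₁ : IsSkewStable α 1 S₁ P) (h₂ : IsSkewStable α 1 S₂ P)
    (hind : IndepFun S₁ S₂ P) {b l : ℝ} (hb : 0 < b) (hl : 0 < l) :
    charFun (P.map fun ω => S₂ ω - b * S₁ ω) l = Complex.exp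
      ((-(1 + b ^ α) * l ^ α : ℝ) +
        (Real.tan (Real.pi * α / 2) * (1 - b ^ α) * l ^ α : ℝ) * Complex.I) := by
  have hm : AEMeasurable (fun ω => -b * S₁ ω) P := h₁.aemeasurable.const_mul _
  have hi : IndepFun S₂ (fun ω => -b * S₁ ω) P :=
    (hind.comp (φ := fun x => -b * x) (ψ := id) (by fun_prop) measurable_id).symm
  have hadd := hi.charFun_map_fun_add_eq_mul h₂.aemeasurable hm
  have hfun : (fun ω => S₂ ω - b * S₁ ω) = fun ω => S₂ ω + -b * S₁ ω := by
    funext ω; ring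
  rw [hfun, hadd, Pi.mul_apply, charFun_map_mul_comp h₁.aemeasurable, h₁.charFun_map,
    h₂.charFun_map, neg_mul, skewStableCharFun_one_neg α (mul_pos hb hl),
    skewStableCharFun_one_of_pos α hl, ← Complex.exp_add, Real.mul_rpow hb.le hl.le]
  congr 1
  push_cast
  ring

lemma integral_sign_map_sub_mul (hα : 0 < α) (h₁ : IsSkewStable α 1 S₁ P)
    (h₂ : IsSkewStable α 1 S₂ P) (hind : IndepFun S₁ S₂ P) {b : ℝ} (hb : 0 < b) :
    ∫ x, (SignType.sign x : ℝ) ∂(P.map fun ω => S₂ ω - b * S₁ ω) =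
      2 / (Real.pi * α) *
        Real.arctan (Real.tan (Real.pi * α / 2) * (1 - b ^ α) / (1 + b ^ α)) := by
  have := Measure.isProbabilityMeasure_map (μ := P)
    (h₂.aemeasurable.sub (h₁.aemeasurable.const_mul b))
  refine integral_sign_of_charFun_im _ hα (by positivity) fun l hl => ?_
  rw [charFun_map_sub_mul h₁ h₂ hind hb hl, exp_ofReal_add_ofReal_mul_I_im]

/-- The distribution function of `(S₂ / S₁) ^ α` for independent `S₁, S₂` of law `S(α, 1, 1)`. -/
noncomputable def powRatioCDF (α x : ℝ) : ℝ :=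
  1 / 2 - Real.arctan (Real.tan (Real.pi * α / 2) * (1 - x) / (1 + x)) / (Real.pi * α)

lemma one_sub_integral_sign_div_two (hα : 0 < α) (h₁ : IsSkewStable α 1 S₁ P)
    (h₂ : IsSkewStable α 1 S₂ P) (hind : IndepFun S₁ S₂ P) {b : ℝ} (hb : 0 < b) :
    (1 - ∫ x, (SignType.sign x : ℝ) ∂(P.map fun ω => S₂ ω - b * S₁ ω)) / 2 =
      powRatioCDF α (b ^ α) := by
  rw [integral_sign_map_sub_mul hα h₁ h₂ hind hb, powRatioCDF]
  field_simp

theorem measureReal_le_mul_eq_powRatioCDF (hα : 0 < α) (hα1 : α < 1)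
    (h₁ : IsSkewStable α 1 S₁ P) (h₂ : IsSkewStable α 1 S₂ P) (hind : IndepFun S₁ S₂ P)
    {b : ℝ} (hb : 0 < b) :
    P.real {ω | S₂ ω ≤ b * S₁ ω} = powRatioCDF α (b ^ α) := by
  have hm : ∀ b : ℝ, AEMeasurable (fun ω => S₂ ω - b * S₁ ω) P := fun b =>
    h₂.aemeasurable.sub (h₁.aemeasurable.const_mul b)
  have hset : ∀ {s : Set ℝ} (b : ℝ), MeasurableSet s →
      (P.map fun ω => S₂ ω - b * S₁ ω).real s = P.real {ω | S₂ ω - b * S₁ ω ∈ s} := by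
    intro s b hs
    rw [Measure.real, Measure.map_apply_of_aemeasurable (hm b) hs]
    rfl
  have hp : ∀ b, IsProbabilityMeasure (P.map fun ω => S₂ ω - b * S₁ ω) := fun b =>
    Measure.isProbabilityMeasure_map (hm b)
  apply le_antisymm
  -- An atom at `0` is circumvented by letting `b' ↓ b`: as `S₁ > 0` a.s., `S₂ ≤ b S₁` implies `S₂ <
  -- b' S₁`.
  · have hcont : Tendsto (fun b' => powRatioCDF α (b' ^ α)) (𝓝[>] b)
        (𝓝 (powRatioCDF α (b ^ α))) := by
      refine tendsto_nhdsWithin_of_tendsto_nhds (ContinuousAt.tendsto ?_)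
      have h1 : ContinuousAt (fun b' : ℝ => b' ^ α) b :=
        Real.continuousAt_rpow_const _ _ (Or.inl hb.ne')
      have h2 : 1 + b ^ α ≠ 0 := by positivity
      unfold powRatioCDF
      fun_prop (disch := assumption)
    refine ge_of_tendsto hcont ?_
    filter_upwards [self_mem_nhdsWithin] with b' hb'
    have hb' : b < b' := hb'
    rw [← one_sub_integral_sign_div_two hα h₁ h₂ hind (hb.trans hb')]
    refine le_trans ?_ (measureReal_Iio_le_of_integral_sign _)
    rw [hset b' measurableSet_Iio]
    refine ENNReal.toReal_mono (measure_ne_top _ _) (measure_mono_ae ?_)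
    filter_upwards [h₁.ae_pos hα hα1] with ω hω hle
    have hle : S₂ ω ≤ b * S₁ ω := hle
    show S₂ ω - b' * S₁ ω < 0
    nlinarith
  · rw [← one_sub_integral_sign_div_two hα h₁ h₂ hind hb]
    refine (le_measureReal_Iic_of_integral_sign _).trans_eq ?_
    rw [hset b measurableSet_Iic]
    simp

theorem ratioCDF_eq_powRatioCDF (hα : 0 < α) (hα1 : α < 1)
    (h₁ : IsSkewStable α 1 S₁ P) (h₂ : IsSkewStable α 1 S₂ P) (hind : IndepFun S₁ S₂ P)
    {t : ℝ} (ht : 0 < t) :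
    ratioCDF P S₁ S₂ α t = powRatioCDF α (t ^ (1 - α)) := by
  have h1α : 0 < 1 - α := by linarith
  have hb : 0 < t ^ ((1 - α) / α) := Real.rpow_pos_of_pos ht _
  have hx : (t ^ ((1 - α) / α)) ^ α = t ^ (1 - α) := by
    rw [← Real.rpow_mul ht.le, div_mul_cancel₀ _ hα.ne']
  rw [← hx, ← measureReal_le_mul_eq_powRatioCDF hα hα1 h₁ h₂ hind hb, ratioCDF]
  refine measureReal_congr ?_
  filter_upwards [h₁.ae_pos hα hα1, h₂.ae_pos hα hα1] with ω hω₁ hω₂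
  refine propext (show (S₂ ω / S₁ ω) ^ (α / (1 - α)) ≤ t ↔ S₂ ω ≤ _ * S₁ ω from ?_)
  rw [← Real.le_rpow_inv_iff_of_pos (div_pos hω₂ hω₁).le ht.le (div_pos hα h1α), inv_div,
    div_le_iff₀ hω₁]

lemma ratioCDF_zero (hα : 0 < α) (hα1 : α < 1)
    (h₁ : IsSkewStable α 1 S₁ P) (h₂ : IsSkewStable α 1 S₂ P) :
    ratioCDF P S₁ S₂ α 0 = 0 := by
  have h : ∀ᵐ ω ∂P, ¬ (S₂ ω / S₁ ω) ^ (α / (1 - α)) ≤ 0 := by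
    filter_upwards [h₁.ae_pos hα hα1, h₂.ae_pos hα hα1] with ω hω₁ hω₂
    exact (Real.rpow_pos_of_pos (div_pos hω₂ hω₁) _).not_ge
  rw [ratioCDF, measureReal_eq_zero_iff]
  simpa [ae_iff] using h

end SkewStable

/-! ### Two-sided linear bounds for the distribution function. -/

lemma hasDerivAt_arctan_mul_sub_div_add (T : ℝ) {x : ℝ} (hx : 0 ≤ x) :
    HasDerivAt (fun x => Real.arctan (T * (1 - x) / (1 + x)))
      (-(2 * T / ((1 + x) ^ 2 + T ^ 2 * (1 - x) ^ 2))) x := by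
  have h0 : 1 + x ≠ 0 := by positivity
  have h1 : HasDerivAt (fun x => T * (1 - x)) (T * (-1)) x :=
    ((hasDerivAt_id x).const_sub 1).const_mul T
  have h2 : HasDerivAt (fun x => 1 + x) 1 x := (hasDerivAt_id x).const_add 1
  convert (h1.fun_div h2 h0).arctan using 1
  have h3 : (1 + x) ^ 2 + T ^ 2 * (1 - x) ^ 2 ≠ 0 := by positivity
  have h4 : 1 + (T * (1 - x) / (1 + x)) ^ 2 ≠ 0 := by positivity
  field_simp
  ring

/-- Compare derivatives: `(1 + y)² + T² (1 - y)² - (1 + T²) = 2 y (1 - T²) + y² (1 + T²)`,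
nonnegative because `T ≤ 1`. This is where `α ≤ 1 / 2` matters. -/
lemma arctan_sub_arctan_le {T x : ℝ} (hT : 0 ≤ T) (hT1 : T ≤ 1) (hx : 0 ≤ x) :
    Real.arctan T - Real.arctan (T * (1 - x) / (1 + x)) ≤ 2 * T / (1 + T ^ 2) * x := by
  have hd : ∀ y ∈ Set.Ici (0 : ℝ), HasDerivAt
      (fun y => 2 * T / (1 + T ^ 2) * y + Real.arctan (T * (1 - y) / (1 + y)))
      (2 * T / (1 + T ^ 2) + -(2 * T / ((1 + y) ^ 2 + T ^ 2 * (1 - y) ^ 2))) y := fun y hy => by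
    simpa using ((hasDerivAt_id y).const_mul (2 * T / (1 + T ^ 2))).fun_add
      (hasDerivAt_arctan_mul_sub_div_add T hy)
  have hmono := monotoneOn_of_hasDerivWithinAt_nonneg (convex_Ici (0 : ℝ))
    (fun y hy => (hd y hy).continuousAt.continuousWithinAt)
    (fun y hy => (hd y (interior_subset hy)).hasDerivWithinAt) (fun y hy => by
      have hy : 0 ≤ y := interior_subset hy
      rw [← sub_eq_add_neg, sub_nonneg]
      refine div_le_div_of_nonneg_left (by positivity) (by positivity) ?_
      nlinarith [mul_nonneg hy (by nlinarith : 0 ≤ 1 - T ^ 2), sq_nonneg (T * y), sq_nonneg y])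
  have := hmono (Set.mem_Ici.mpr le_rfl) (Set.mem_Ici.mpr hx) hx
  simp only [mul_zero, sub_zero, add_zero, mul_one, div_one, zero_add] at this
  linarith

/-- Compare derivatives, using `(1 - y)² ≤ (1 + y)²` for `y ≥ 0`. -/
lemma le_arctan_sub_arctan {T x : ℝ} (hT : 0 ≤ T) (hx : 0 ≤ x) :
    2 * T / (1 + T ^ 2) * (x / (1 + x)) ≤
      Real.arctan T - Real.arctan (T * (1 - x) / (1 + x)) := by
  have hd : ∀ y ∈ Set.Ici (0 : ℝ), HasDerivAt
      (fun y => -(2 * T / (1 + T ^ 2) * (y / (1 + y))) - Real.arctan (T * (1 - y) / (1 + y)))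
      (-(2 * T / (1 + T ^ 2) * (1 / (1 + y) ^ 2)) -
        -(2 * T / ((1 + y) ^ 2 + T ^ 2 * (1 - y) ^ 2))) y := fun y hy => by
    have hy : 0 ≤ y := hy
    have h0 : 1 + y ≠ 0 := by positivity
    have h := (hasDerivAt_id y).fun_div ((hasDerivAt_id y).const_add 1) h0
    have h' : HasDerivAt (fun y : ℝ => y / (1 + y)) (1 / (1 + y) ^ 2) y := by
      simpa using h
    exact (h'.const_mul _).neg.sub (hasDerivAt_arctan_mul_sub_div_add T hy)
  have hmono := monotoneOn_of_hasDerivWithinAt_nonneg (convex_Ici (0 : ℝ))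
    (fun y hy => (hd y hy).continuousAt.continuousWithinAt)
    (fun y hy => (hd y (interior_subset hy)).hasDerivWithinAt) (fun y hy => by
      have hy : 0 ≤ y := interior_subset hy
      rw [sub_neg_eq_add, neg_add_eq_sub, sub_nonneg, div_mul_div_comm, mul_one]
      gcongr
      nlinarith [mul_nonneg hy (sq_nonneg T)])
  have := hmono (Set.mem_Ici.mpr le_rfl) (Set.mem_Ici.mpr hx) hx
  simp only [sub_zero, add_zero, mul_one, div_one, mul_zero, neg_zero, zero_sub] at this
  linarith

/-- The limit of `x / powRatioCDF α x` as `x → 0`. -/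
noncomputable def skewStableConst (α : ℝ) : ℝ := Real.pi * α / Real.sin (Real.pi * α)

lemma sin_eq_two_mul_tan_div {y : ℝ} (hy : Real.cos y ≠ 0) :
    Real.sin (2 * y) = 2 * Real.tan y / (1 + Real.tan y ^ 2) := by
  have h := Real.sin_sq_add_cos_sq y
  have h2 : 1 + Real.tan y ^ 2 = 1 / Real.cos y ^ 2 := by
    rw [Real.tan_eq_sin_div_cos]; field_simp; linarith
  rw [h2, Real.sin_two_mul, Real.tan_eq_sin_div_cos]
  field_simp

lemma powRatioCDF_bounds {α x : ℝ} (hα : 0 < α) (hα2 : α ≤ 1 / 2) (hx : 0 ≤ x) :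
    x / (1 + x) / skewStableConst α ≤ powRatioCDF α x ∧
      powRatioCDF α x ≤ x / skewStableConst α := by
  have hpi := Real.pi_pos
  have hT : 0 ≤ Real.tan (Real.pi * α / 2) :=
    Real.tan_nonneg_of_nonneg_of_le_pi_div_two (by positivity) (by nlinarith)
  have hT1 : Real.tan (Real.pi * α / 2) ≤ 1 := by
    rw [← Real.tan_pi_div_four]
    exact Real.strictMonoOn_tan.monotoneOn ⟨by nlinarith, by nlinarith⟩
      ⟨by linarith, by linarith⟩ (by nlinarith)
  have hsin : Real.sin (Real.pi * α) =
      2 * Real.tan (Real.pi * α / 2) / (1 + Real.tan (Real.pi * α / 2) ^ 2) := by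
    rw [← sin_eq_two_mul_tan_div]
    · ring_nf
    · exact (Real.cos_pos_of_mem_Ioo ⟨by nlinarith, by nlinarith⟩).ne'
  have hG : powRatioCDF α x = (Real.arctan (Real.tan (Real.pi * α / 2)) -
      Real.arctan (Real.tan (Real.pi * α / 2) * (1 - x) / (1 + x))) / (Real.pi * α) := by
    rw [powRatioCDF, arctan_tan_pi_mul_div_two hα (by linarith)]
    field_simp
  have hC : ∀ y, y / skewStableConst α =
      2 * Real.tan (Real.pi * α / 2) / (1 + Real.tan (Real.pi * α / 2) ^ 2) * y /
        (Real.pi * α) := by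
    intro y
    rw [skewStableConst, ← hsin, div_div_eq_mul_div, mul_comm y]
  rw [hG, hC, hC]
  exact ⟨by gcongr; exact le_arctan_sub_arctan hT hx,
    by gcongr; exact arctan_sub_arctan_le hT hT1 hx⟩

/-! ### The constant and the uniform error term. -/

lemma sin_pi_mul_pos {α : ℝ} (hα : 0 < α) (hα1 : α < 1) : 0 < Real.sin (Real.pi * α) :=
  Real.sin_pos_of_pos_of_lt_pi (by positivity) (by nlinarith [Real.pi_pos])

lemma one_le_skewStableConst {α : ℝ} (hα : 0 < α) (hα1 : α < 1) : 1 ≤ skewStableConst α := by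
  rw [skewStableConst, one_le_div (sin_pi_mul_pos hα hα1)]
  exact Real.sin_le (by positivity)

lemma skewStableConst_le {α : ℝ} (hα : 0 < α) (hα2 : α ≤ 1 / 2) :
    skewStableConst α ≤ Real.pi / 2 := by
  -- Jordan's inequality `2 y / π ≤ sin y` at `y = π α ≤ π / 2`.
  have hpi := Real.pi_pos
  rw [skewStableConst, div_le_iff₀ (sin_pi_mul_pos hα (by linarith))]
  have := Real.mul_le_sin (x := Real.pi * α) (by positivity) (by nlinarith)
  calc Real.pi * α = Real.pi / 2 * (2 / Real.pi * (Real.pi * α)) := by field_simp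
    _ ≤ _ := by gcongr

lemma tendsto_skewStableConst : Tendsto skewStableConst (𝓝[>] 0) (𝓝 1) := by
  have h1 : Tendsto (fun α : ℝ => (Real.sinc (Real.pi * α))⁻¹) (𝓝 0)
      (𝓝 (Real.sinc (Real.pi * 0))⁻¹) := by
    refine Tendsto.inv₀ (Continuous.tendsto (by fun_prop) 0) (by simp)
  simp only [mul_zero, Real.sinc_zero, inv_one] at h1
  refine (h1.mono_left nhdsWithin_le_nhds).congr' ?_
  filter_upwards [self_mem_nhdsWithin] with α hα
  have hα : 0 < α := hα
  rw [Real.sinc_of_ne_zero (by positivity), inv_div, skewStableConst]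

/-- The error term: for `t > 0`, `skewStableConst α + ratioError α t` is the quotient of
`t ^ (1 - α)` by the value at `t` of the distribution function of the ratio. -/
noncomputable def ratioError (α t : ℝ) : ℝ :=
  if t ≤ 0 then 0 else t ^ (1 - α) / powRatioCDF α (t ^ (1 - α)) - skewStableConst α

lemma ratioError_bounds {α t : ℝ} (hα : 0 < α) (hα2 : α ≤ 1 / 2) (ht : 0 < t) :
    0 ≤ ratioError α t ∧ ratioError α t ≤ skewStableConst α * t ^ (1 - α) := by
  have hx : 0 < t ^ (1 - α) := Real.rpow_pos_of_pos ht _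
  have hC : 0 < skewStableConst α := one_pos.trans_le (one_le_skewStableConst hα (by linarith))
  obtain ⟨hl, hu⟩ := powRatioCDF_bounds hα hα2 hx.le
  have hG : 0 < powRatioCDF α (t ^ (1 - α)) := lt_of_lt_of_le (by positivity) hl
  rw [ratioError, if_neg ht.not_ge]
  constructor
  · rw [sub_nonneg, le_div_iff₀ hG]
    rwa [le_div_iff₀ hC, mul_comm] at hu
  · rw [sub_le_iff_le_add, div_le_iff₀ hG]
    rw [div_div, div_le_iff₀ (by positivity)] at hl
    linarith

lemma tendstoUniformlyOn_ratioError :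
    TendstoUniformlyOn (fun t α => ratioError α t) (fun _ => 0) (𝓝[>] 0)
      (Set.Ioc (0 : ℝ) (1 / 2)) := by
  rw [Metric.tendstoUniformlyOn_iff]
  intro ε hε
  -- A majorant free of `α`: `C_α ≤ π / 2`, and `t^(1-α) ≤ t^(1/2)` for `t < 1`.
  have h1 : Tendsto (fun t : ℝ => Real.pi / 2 * t ^ (1 / 2 : ℝ)) (𝓝[>] 0) (𝓝 0) := by
    have : ContinuousAt (fun t : ℝ => Real.pi / 2 * t ^ (1 / 2 : ℝ)) 0 :=
      continuousAt_const.mul (Real.continuousAt_rpow_const _ _ (Or.inr (by norm_num)))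
    have h := this.tendsto
    rw [Real.zero_rpow (by norm_num), mul_zero] at h
    exact h.mono_left nhdsWithin_le_nhds
  filter_upwards [h1.eventually (gt_mem_nhds hε), Ioo_mem_nhdsGT (one_pos : (0 : ℝ) < 1)]
    with t ht htm α hα
  obtain ⟨hl, hu⟩ := ratioError_bounds hα.1 hα.2 htm.1
  rw [dist_comm, Real.dist_0_eq_abs, abs_of_nonneg hl]
  refine (hu.trans ?_).trans_lt ht
  have := Real.pi_pos
  refine mul_le_mul (skewStableConst_le hα.1 hα.2) ?_ (Real.rpow_nonneg htm.1.le _) (by positivity)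
  exact Real.rpow_le_rpow_of_exponent_ge htm.1 htm.2.le (by linarith [hα.2])

theorem lemma3 :
    -- the constant `C_α`, the error term `r α t = o(1)`, and the absolute constants of `Θ`
    ∃ (C : ℝ → ℝ) (r : ℝ → ℝ → ℝ) (c₁ c₂ : ℝ),
      (∀ α ∈ Set.Ioc (0 : ℝ) (1 / 2), 0 < C α) ∧
      Tendsto C (𝓝[>] 0) (𝓝 1) ∧
      C (1 / 2) = Real.pi / 2 ∧
      -- `r α t → 0` as `t → 0+`, uniformly in `α ∈ (0, 1/2]`
      TendstoUniformlyOn (fun t α => r α t) (fun _ => 0) (𝓝[>] 0) (Set.Ioc (0 : ℝ) (1 / 2)) ∧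
      0 < c₁ ∧ 0 < c₂ ∧
      ∀ (α t : ℝ), 0 < α → α ≤ 1 / 2 → 0 ≤ t → t < α ^ (α / (1 - α)) →
        ∀ {Ω : Type*} [MeasurableSpace Ω] (P : Measure Ω) [IsProbabilityMeasure P]
          (S₁ S₂ : Ω → ℝ),
          IsSkewStable α 1 S₁ P → IsSkewStable α 1 S₂ P → IndepFun S₁ S₂ P →
            0 < C α + r α t ∧
            ratioCDF P S₁ S₂ α t = t ^ (1 - α) / (C α + r α t) ∧
            c₁ * t ^ (1 - α) ≤ ratioCDF P S₁ S₂ α t ∧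
            ratioCDF P S₁ S₂ α t ≤ c₂ * t ^ (1 - α) := by
  have hpi := Real.pi_pos
  -- `c₁ = 1 / π` and `c₂ = 1` come from `1 ≤ C_α ≤ C_α + r ≤ 2 C_α ≤ π`, valid for `t ≤ 1`.
  refine ⟨skewStableConst, ratioError, 1 / Real.pi, 1, fun α hα => ?_, tendsto_skewStableConst,
    ?_, tendstoUniformlyOn_ratioError, by positivity, one_pos, ?_⟩
  · exact one_pos.trans_le (one_le_skewStableConst hα.1 (by linarith [hα.2]))
  · rw [skewStableConst, mul_one_div, Real.sin_pi_div_two, div_one]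
  intro α t hα hα2 ht htα Ω _ P _ S₁ S₂ h₁ h₂ hind
  have hα1 : α < 1 := by linarith
  have hC1 := one_le_skewStableConst hα hα1
  have hC2 := skewStableConst_le hα hα2
  have hC : 0 < skewStableConst α := one_pos.trans_le hC1
  rcases ht.eq_or_lt with rfl | ht
  -- At `t = 0` the error term is `0` by convention, so the denominator is `C_α > 0` and both sides
  -- vanish.
  · rw [ratioCDF_zero hα hα1 h₁ h₂, Real.zero_rpow (by linarith)]
    simp [ratioError, hC]
  obtain ⟨hr, hr'⟩ := ratioError_bounds hα hα2 ht
  have ht1 : t ≤ 1 := htα.le.trans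
    (Real.rpow_le_one hα.le hα1.le (div_nonneg hα.le (by linarith)))
  have hx : 0 < t ^ (1 - α) := Real.rpow_pos_of_pos ht _
  have hx1 : t ^ (1 - α) ≤ 1 := Real.rpow_le_one ht.le ht1 (by linarith)
  have hF : ratioCDF P S₁ S₂ α t = t ^ (1 - α) / (skewStableConst α + ratioError α t) := by
    rw [ratioCDF_eq_powRatioCDF hα hα1 h₁ h₂ hind ht, ratioError, if_neg ht.not_ge,
      add_sub_cancel, div_div_cancel₀ hx.ne']
  refine ⟨by linarith, hF, ?_, ?_⟩
  · rw [hF, le_div_iff₀ (by linarith), one_div_mul_eq_div, div_mul_eq_mul_div,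
      div_le_iff₀ hpi]
    gcongr
    nlinarith
  · rw [hF, one_mul]
    exact div_le_self hx.le (by linarith)
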